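/- Let $n\ge 1$, let $\Omega\subset\mathbb R^n$ be a Borel set and let $F\subset\overline\Omega$ be non-empty and closed with $\lambda(F\cap\Omega)=0$, where $\lambda$ is Lebesgue measure. For $\delta>0$ let $F_\delta=\{x\in\mathbb R^n: \operatorname{dist}(x,F)<\delta\}$, and suppose that $\lambda(F_\delta\cap\Omega)>0$ for every $\delta>0$. A density measure for $F$ is a bounded, finitely additive set function $\mu\ge 0$ on the Borel subsets of $\Omega$ such that $\mu(B)=0$ whenever $\lambda(B)=0$, and $\mu(F_\delta\cap\Omega)=\mu(\Omega)=1$ for all $\delta>0$; let $\operatorname{Dens}(F)$ be the set of all of them. For a bounded finitely additive $\mu$, a function $f:\Omega\to\mathbb R$ is $\mu$-integrable with integral $\int_\Omega f\,d\mu=\lim_k\int_\Omega s_k\,d\mu$ if there are Borel simple functions $s_k$ with $|\mu|^*(\{|s_k-f|>\varepsilon\})\to0$ for every $\varepsilon>0$ and $\int_\Omega|s_k-s_l|\,d|\mu|\to0$ as $k,l\to\infty$; here $|\mu|$ is the total variation of $\mu$ and $|\mu|^*(S)=\inf\{|\mu|(A): A\supseteq S\text{ Borel in }\Omega\}$. Let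 $f\in L^\infty(\Omega)$ (with respect to $\lambda$). Then $f$ is integrable with a uniquely determined integral with respect to every $\mu\in\operatorname{Dens}(F)$, the limits below exist in $\mathbb R$, and $$\Big\{\int_\Omega f\,d\mu : \mu\in \operatorname{Dens}(F)\Big\}=\Big[\lim_{\delta\downarrow0}\operatorname*{ess\,inf}_{F_\delta\cap\Omega}f,\ \lim_{\delta\downarrow0}\operatorname*{ess\,sup}_{F_\delta\cap\Omega}f\Big],$$ where the essential infimum and supremum are taken with respect to $\lambda$ and the first limit is at most the second. -/

import Mathlib

open MeasureTheory Set Filter Topology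
open scoped ENNReal

/-- A bounded finitely additive real-valued set function on the measurable subsets of `X`,
an element of `ba(X, 𝒜)` with `𝒜` the `σ`-algebra of `X`. As for Mathlib's `VectorMeasure`, the
function is extended by the value `0` to the non-measurable sets. -/
structure BddCharge (X : Type*) [MeasurableSpace X] where
  toFun : Set X → ℝ
  not_measurable' : ∀ A : Set X, ¬ MeasurableSet A → toFun A = 0
  additive' : ∀ A B : Set X, MeasurableSet A → MeasurableSet B → Disjoint A B →
    toFun (A ∪ B) = toFun A + toFun B
  bounded' : ∃ C : ℝ, ∀ A : Set X, MeasurableSet A → |toFun A| ≤ C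

namespace BddCharge

variable {X : Type*} [MeasurableSpace X]

instance : CoeFun (BddCharge X) (fun _ => Set X → ℝ) := ⟨BddCharge.toFun⟩

/-- `μ ≥ 0`. -/
def Nonneg (μ : BddCharge X) : Prop := ∀ A : Set X, MeasurableSet A → 0 ≤ μ A

/-- `μ` is weakly absolutely continuous with respect to the (`σ`-additive, nonnegative) measure
`m`: it vanishes on every measurable `m`-null set. -/
def WeaklyAbsCont (μ : BddCharge X) (m : Measure X) : Prop :=
  ∀ A : Set X, MeasurableSet A → m A = 0 → μ A = 0

/-- The positive part `μ⁺(A) = sup {μ(B) : B ⊆ A measurable}`. -/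
noncomputable def posPart (μ : BddCharge X) (A : Set X) : ℝ :=
  sSup {r : ℝ | ∃ B : Set X, MeasurableSet B ∧ B ⊆ A ∧ μ B = r}

/-- The negative part `μ⁻(A) = sup {-μ(B) : B ⊆ A measurable}`. -/
noncomputable def negPart (μ : BddCharge X) (A : Set X) : ℝ :=
  sSup {r : ℝ | ∃ B : Set X, MeasurableSet B ∧ B ⊆ A ∧ -μ B = r}

/-- The total variation `|μ| = μ⁺ + μ⁻` (evaluated on measurable sets). -/
noncomputable def totalVar (μ : BddCharge X) (A : Set X) : ℝ := μ.posPart A + μ.negPart A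

/-- The outer measure of `|μ|`: for an arbitrary set `S`,
`|μ|^*(S) = inf {|μ|(A) : A measurable, S ⊆ A}`. -/
noncomputable def outerVar (μ : BddCharge X) (S : Set X) : ℝ :=
  sInf {r : ℝ | ∃ A : Set X, MeasurableSet A ∧ S ⊆ A ∧ μ.totalVar A = r}

/-- The integral `∑ y, y * m {s = y}` of a simple function `s` with respect to a set function. -/
noncomputable def simpleIntegral (m : Set X → ℝ) (s : SimpleFunc X ℝ) : ℝ :=
  ∑ y ∈ s.range, y * m (s ⁻¹' {y})

/-- Convergence in measure: `|μ|^* {|s k - f| > ε} → 0` for every `ε > 0`. -/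
def ConvergesInMeasure (μ : BddCharge X) (s : ℕ → SimpleFunc X ℝ) (f : X → ℝ) : Prop :=
  ∀ ε : ℝ, 0 < ε → Tendsto (fun k => μ.outerVar {x | ε < |s k x - f x|}) atTop (𝓝 0)

/-- `s` is a determining sequence of `f`: simple functions which converge to `f` in measure and
are Cauchy in `L¹(|μ|)`, i.e. `∫ |s k - s l| d|μ| → 0` as `k, l → ∞`. -/
def IsDetermining (μ : BddCharge X) (s : ℕ → SimpleFunc X ℝ) (f : X → ℝ) : Prop :=
  μ.ConvergesInMeasure s f ∧
    Tendsto (fun p : ℕ × ℕ =>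
      simpleIntegral μ.totalVar ((s p.1 - s p.2).map (fun y => |y|))) atTop (𝓝 0)

/-- `f` is integrable with respect to the finitely additive `μ`, and `∫ f dμ = c`. -/
def HasIntegral (μ : BddCharge X) (f : X → ℝ) (c : ℝ) : Prop :=
  ∃ s : ℕ → SimpleFunc X ℝ, μ.IsDetermining s f ∧
    Tendsto (fun k => simpleIntegral μ (s k)) atTop (𝓝 c)

end BddCharge

/-- The trace `F_δ ∩ Ω` on `Ω` of the open `δ`-neighbourhood of `F`, as a subset of `Ω`. -/
def nhdIn {n : ℕ} (Ω F : Set (EuclideanSpace ℝ (Fin n))) (δ : ℝ) : Set Ω :=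
  {x : Ω | (x : EuclideanSpace ℝ (Fin n)) ∈ Metric.thickening δ F}

/-- Lebesgue measure on the Borel subsets of a Borel set `Ω`. -/
noncomputable def lebesgueOn {n : ℕ} (Ω : Set (EuclideanSpace ℝ (Fin n))) : Measure Ω :=
  Measure.comap (fun x : Ω => (x : EuclideanSpace ℝ (Fin n))) volume

/-- `μ`, a bounded finitely additive set function on the Borel subsets of `Ω`, is a density measure
for `F`: it is nonnegative, it vanishes on the Lebesgue null sets of `Ω` and
`μ(F_δ ∩ Ω) = μ(Ω) = 1` for every `δ > 0`. -/
structure IsDensityMeasure {n : ℕ} (Ω F : Set (EuclideanSpace ℝ (Fin n)))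
    (μ : BddCharge Ω) : Prop where
  nonneg : μ.Nonneg
  weaklyAbsCont : μ.WeaklyAbsCont (lebesgueOn Ω)
  total : μ univ = 1
  nhd : ∀ δ : ℝ, 0 < δ → μ (nhdIn Ω F δ) = 1

/-! A density measure ignores Lebesgue null sets and the complement of each `nhdIn Ω F δ`
(`IsDensityMeasure.apply_eq_zero`). So `f` may be replaced by a bounded Borel representative `g`,
and the integral lies between the essential bounds of `g` on every neighbourhood of `F`, hence
between their limits `a` and `b`.

Both limits are attained. Near `F` the function `g` is within `r` of `b` on a set of positive
measure, for every `r > 0`. Thus `(0, b)` is a cluster point of `(dist(·, F), g)` along the a.e.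
filter, and an ultrafilter realising it defines a 0-1 valued density measure with integral `b`
(`exists_isDensityMeasure_hasIntegral`); likewise for `a`. Density measures form a convex set on
which the integral is affine, so the whole segment is attained. -/

namespace BddCharge

variable {X : Type*} [MeasurableSpace X] {μ : BddCharge X}

/-! ### Nonnegative charges: monotonicity, total variation, outer measure. -/

theorem apply_empty (μ : BddCharge X) : μ ∅ = 0 := by
  have h := μ.additive' ∅ ∅ .empty .empty (disjoint_empty _)
  simp only [union_self] at h
  linarith

theorem Nonneg.mono (hμ : μ.Nonneg) {A B : Set X} (hA : MeasurableSet A) (hB : MeasurableSet B)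
    (hAB : A ⊆ B) : μ A ≤ μ B := by
  have h := μ.additive' A (B \ A) hA (hB.diff hA) disjoint_sdiff_right
  rw [union_sdiff_cancel hAB] at h
  linarith [hμ _ (hB.diff hA)]

theorem Nonneg.union_le (hμ : μ.Nonneg) {A B : Set X} (hA : MeasurableSet A)
    (hB : MeasurableSet B) : μ (A ∪ B) ≤ μ A + μ B := by
  have h := μ.additive' A (B \ A) hA (hB.diff hA) disjoint_sdiff_right
  rw [union_sdiff_self] at h
  linarith [hμ.mono (hB.diff hA) hB sdiff_subset]

theorem Nonneg.posPart_eq (hμ : μ.Nonneg) {A : Set X} (hA : MeasurableSet A) :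
    μ.posPart A = μ A := by
  refine IsGreatest.csSup_eq ⟨⟨A, hA, subset_rfl, rfl⟩, ?_⟩
  rintro r ⟨B, hB, hBA, rfl⟩
  exact hμ.mono hB hA hBA

theorem Nonneg.negPart_eq (hμ : μ.Nonneg) (A : Set X) : μ.negPart A = 0 := by
  refine IsGreatest.csSup_eq ⟨⟨∅, .empty, empty_subset _, by simp [apply_empty]⟩, ?_⟩
  rintro r ⟨B, hB, -, rfl⟩
  simpa using hμ B hB

theorem Nonneg.totalVar_eq (hμ : μ.Nonneg) {A : Set X} (hA : MeasurableSet A) :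
    μ.totalVar A = μ A := by
  rw [totalVar, hμ.posPart_eq hA, hμ.negPart_eq, add_zero]

theorem Nonneg.simpleIntegral_totalVar (hμ : μ.Nonneg) (s : SimpleFunc X ℝ) :
    simpleIntegral μ.totalVar s = simpleIntegral μ s :=
  Finset.sum_congr rfl fun y _ => by rw [hμ.totalVar_eq (s.measurableSet_fiber y)]

theorem Nonneg.bddBelow_outerVar (hμ : μ.Nonneg) (S : Set X) :
    BddBelow {r : ℝ | ∃ A : Set X, MeasurableSet A ∧ S ⊆ A ∧ μ.totalVar A = r} := by
  refine ⟨0, ?_⟩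
  rintro r ⟨A, hA, -, rfl⟩
  rw [hμ.totalVar_eq hA]
  exact hμ A hA

theorem Nonneg.outerVar_nonneg (hμ : μ.Nonneg) (S : Set X) : 0 ≤ μ.outerVar S := by
  refine Real.sInf_nonneg ?_
  rintro r ⟨A, hA, -, rfl⟩
  rw [hμ.totalVar_eq hA]
  exact hμ A hA

theorem Nonneg.outerVar_le (hμ : μ.Nonneg) {S A : Set X} (hA : MeasurableSet A) (hSA : S ⊆ A) :
    μ.outerVar S ≤ μ A :=
  csInf_le (hμ.bddBelow_outerVar S) ⟨A, hA, hSA, hμ.totalVar_eq hA⟩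

theorem Nonneg.exists_lt_of_outerVar_lt (hμ : μ.Nonneg) {S : Set X} {r : ℝ}
    (h : μ.outerVar S < r) : ∃ A, MeasurableSet A ∧ S ⊆ A ∧ μ A < r := by
  obtain ⟨_, ⟨A, hA, hSA, rfl⟩, hr⟩ :=
    exists_lt_of_csInf_lt (s := {r : ℝ | ∃ A : Set X, MeasurableSet A ∧ S ⊆ A ∧ μ.totalVar A = r})
      ⟨_, univ, .univ, subset_univ _, rfl⟩ h
  exact ⟨A, hA, hSA, hμ.totalVar_eq hA ▸ hr⟩

/-! ### Integrals of simple functions. -/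

/-- The operator-valued set function `A ↦ μ A • id`. -/
noncomputable def toCLM (μ : BddCharge X) (A : Set X) : ℝ →L[ℝ] ℝ :=
  μ A • ContinuousLinearMap.id ℝ ℝ

theorem toCLM_apply (μ : BddCharge X) (A : Set X) (y : ℝ) : μ.toCLM A y = μ A * y := rfl

/-- For the zero measure every set has finite measure and every simple function is integrable, so
the `setToSimpleFunc` calculus applies to a charge without side conditions. -/
theorem finMeasAdditive_toCLM (μ : BddCharge X) :
    FinMeasAdditive (0 : Measure X) μ.toCLM := fun A B hA hB _ _ hAB => by
  ext
  simp [toCLM_apply, μ.additive' A B hA hB hAB]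

theorem simpleIntegral_eq (μ : BddCharge X) (s : SimpleFunc X ℝ) :
    simpleIntegral μ s = s.setToSimpleFunc μ.toCLM :=
  Finset.sum_congr rfl fun y _ => by rw [toCLM_apply, mul_comm]

theorem simpleIntegral_add (μ : BddCharge X) (s t : SimpleFunc X ℝ) :
    simpleIntegral μ (s + t) = simpleIntegral μ s + simpleIntegral μ t := by
  simp only [simpleIntegral_eq]
  exact SimpleFunc.setToSimpleFunc_add _ μ.finMeasAdditive_toCLM
    integrable_zero_measure integrable_zero_measure

theorem simpleIntegral_sub (μ : BddCharge X) (s t : SimpleFunc X ℝ) :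
    simpleIntegral μ (s - t) = simpleIntegral μ s - simpleIntegral μ t := by
  simp only [simpleIntegral_eq]
  exact SimpleFunc.setToSimpleFunc_sub _ μ.finMeasAdditive_toCLM
    integrable_zero_measure integrable_zero_measure

theorem simpleIntegral_const (μ : BddCharge X) (c : ℝ) :
    simpleIntegral μ (SimpleFunc.const X c) = c * μ univ := by
  rw [simpleIntegral_eq, SimpleFunc.setToSimpleFunc_const, toCLM_apply, mul_comm]
  ext
  simp [toCLM_apply, apply_empty]

theorem simpleIntegral_indicator (μ : BddCharge X) {A : Set X} (hA : MeasurableSet A) (c : ℝ) :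
    simpleIntegral μ (SimpleFunc.piecewise A hA (.const X c) (.const X 0)) = c * μ A := by
  rw [simpleIntegral_eq, SimpleFunc.setToSimpleFunc_indicator, toCLM_apply, mul_comm]
  ext
  simp [toCLM_apply, apply_empty]

theorem Nonneg.simpleIntegral_mono (hμ : μ.Nonneg) {s t : SimpleFunc X ℝ} (hst : ∀ x, s x ≤ t x) :
    simpleIntegral μ s ≤ simpleIntegral μ t := by
  simp only [simpleIntegral_eq]
  exact SimpleFunc.setToSimpleFunc_mono μ.finMeasAdditive_toCLM
    (fun A hA _ x hx => mul_nonneg (hμ A hA) hx)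
    integrable_zero_measure integrable_zero_measure hst

/-- Adding `M` times the indicator of `A` to `t` gives pointwise domination; exceptional sets enter
all later estimates this way. -/
theorem Nonneg.simpleIntegral_le_add (hμ : μ.Nonneg) {s t : SimpleFunc X ℝ} {A : Set X}
    (hA : MeasurableSet A) {M : ℝ} (h : ∀ x ∉ A, s x ≤ t x) (h' : ∀ x ∈ A, s x ≤ t x + M) :
    simpleIntegral μ s ≤ simpleIntegral μ t + M * μ A := by
  rw [← simpleIntegral_indicator μ hA M, ← simpleIntegral_add]
  refine hμ.simpleIntegral_mono fun x => ?_
  by_cases hx : x ∈ A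
  · simpa [hx] using h' x hx
  · simpa [hx] using h x hx

theorem Nonneg.simpleIntegral_le_of_null (hμ : μ.Nonneg) {s t : SimpleFunc X ℝ} {A : Set X}
    (hA : MeasurableSet A) (hA0 : μ A = 0) (h : ∀ x ∉ A, s x ≤ t x) :
    simpleIntegral μ s ≤ simpleIntegral μ t := by
  obtain ⟨C, hC⟩ := (s - t).exists_forall_norm_le
  have := hμ.simpleIntegral_le_add hA h (M := C) fun x _ => by
    have := (le_abs_self _).trans (hC x)
    simp only [SimpleFunc.coe_sub, Pi.sub_apply] at this
    linarith
  simpa [hA0] using this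

theorem Nonneg.abs_simpleIntegral_sub_le (hμ : μ.Nonneg) (s t : SimpleFunc X ℝ) :
    |simpleIntegral μ s - simpleIntegral μ t| ≤
      simpleIntegral μ ((s - t).map fun y => |y|) := by
  have h₁ : simpleIntegral μ (s - t) ≤ simpleIntegral μ ((s - t).map fun y => |y|) :=
    hμ.simpleIntegral_mono fun x => by simpa using le_abs_self (s x - t x)
  have h₂ : simpleIntegral μ (t - s) ≤ simpleIntegral μ ((s - t).map fun y => |y|) :=
    hμ.simpleIntegral_mono fun x => by
      simpa [abs_sub_comm (s x)] using le_abs_self (t x - s x)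
  rw [simpleIntegral_sub] at h₁ h₂
  exact abs_le.2 ⟨by linarith, h₁⟩

/-! ### Determining sequences and uniqueness of the integral. -/

/-- The simple integrals of a determining sequence converge. -/
theorem Nonneg.exists_tendsto_of_isDetermining (hμ : μ.Nonneg) {s : ℕ → SimpleFunc X ℝ}
    {f : X → ℝ} (hs : μ.IsDetermining s f) :
    ∃ c, Tendsto (fun k => simpleIntegral μ (s k)) atTop (𝓝 c) := by
  refine cauchySeq_tendsto_of_complete (cauchySeq_iff_tendsto_dist_atTop_0.2 ?_)
  refine squeeze_zero (fun _ => dist_nonneg) (fun p => ?_) hs.2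
  rw [hμ.simpleIntegral_totalVar, Real.dist_eq]
  exact hμ.abs_simpleIntegral_sub_le _ _

/-- The integral does not depend on the determining sequence. -/
theorem Nonneg.hasIntegral_unique (hμ : μ.Nonneg) {f : X → ℝ} {c d : ℝ}
    (hc : μ.HasIntegral f c) (hd : μ.HasIntegral f d) : c = d := by
  obtain ⟨s, ⟨hsm, hsc⟩, hs⟩ := hc
  obtain ⟨t, ⟨htm, htc⟩, ht⟩ := hd
  simp only [hμ.simpleIntegral_totalVar] at hsc htc
  have hU : 0 ≤ μ univ := hμ _ .univ
  refine eq_of_abs_sub_le_all fun ε hε => ?_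
  obtain ⟨δ, hδ, hδε⟩ : ∃ δ : ℝ, 0 < δ ∧ 2 * δ * μ univ + 2 * δ ≤ ε / 2 :=
    ⟨ε / (4 * (μ univ + 1)), by positivity, by
      apply le_of_eq; field_simp; ring⟩
  obtain ⟨⟨a, b⟩, hab⟩ := eventually_atTop.1 (hsc.eventually (gt_mem_nhds hδ))
  obtain ⟨⟨a', b'⟩, hab'⟩ := eventually_atTop.1 (htc.eventually (gt_mem_nhds hδ))
  let K := max (max a b) (max a' b')
  have hsK : ∀ l ≥ K, simpleIntegral μ ((s l - s K).map fun y => |y|) < δ := fun l hl =>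
    hab (l, K) ⟨by simp only [K, ge_iff_le, max_le_iff] at hl; exact hl.1.1, by simp [K]⟩
  have htK : ∀ l ≥ K, simpleIntegral μ ((t l - t K).map fun y => |y|) < δ := fun l hl =>
    hab' (l, K) ⟨by simp only [K, ge_iff_le, max_le_iff] at hl; exact hl.2.1, by simp [K]⟩
  -- The bound is taken at the fixed index `K`, so it does not depend on `l`. Off the exceptional
  -- sets `s l` and `t l` differ by at most `2 * δ`; on them the comparison passes through `s K` and
  -- `t K`. Using `|M| + 1` permits division.
  obtain ⟨M, hM⟩ := (s K - t K).exists_forall_norm_le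
  have hM' : ∀ x, |s K x - t K x| ≤ |M| + 1 := fun x => by
    have := (hM x).trans (le_abs_self M)
    simp only [SimpleFunc.coe_sub, Pi.sub_apply, Real.norm_eq_abs] at this
    linarith
  have hη : 0 < ε / 4 / (|M| + 1) := by positivity
  have key : ∀ᶠ l in atTop, |simpleIntegral μ (s l) - simpleIntegral μ (t l)| ≤ ε := by
    filter_upwards [(hsm δ hδ).eventually (gt_mem_nhds hη),
      (htm δ hδ).eventually (gt_mem_nhds hη), eventually_ge_atTop K] with l h₁ h₂ hl
    obtain ⟨A, hA, hSA, hAη⟩ := hμ.exists_lt_of_outerVar_lt h₁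
    obtain ⟨B, hB, hSB, hBη⟩ := hμ.exists_lt_of_outerVar_lt h₂
    refine (hμ.abs_simpleIntegral_sub_le _ _).trans ?_
    have hle := hμ.simpleIntegral_le_add (s := (s l - t l).map fun y => |y|)
      (t := (s l - s K).map (fun y => |y|) + (t l - t K).map (fun y => |y|)
        + SimpleFunc.const X (2 * δ)) (hA.union hB) (M := |M| + 1)
      (fun x hx => by
        simp only [mem_union, not_or] at hx
        have hx₁ : |s l x - f x| ≤ δ := not_lt.1 fun h => hx.1 (hSA h)
        have hx₂ : |t l x - f x| ≤ δ := not_lt.1 fun h => hx.2 (hSB h)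
        have := abs_sub_le (s l x) (f x) (t l x)
        rw [abs_sub_comm (f x)] at this
        simp only [SimpleFunc.map_apply, SimpleFunc.coe_sub, SimpleFunc.coe_add, Pi.sub_apply,
          Pi.add_apply, SimpleFunc.const_apply]
        linarith [abs_nonneg (s l x - s K x), abs_nonneg (t l x - t K x)])
      (fun x _ => by
        have h₁ := abs_sub_le (s l x) (s K x) (t l x)
        have h₂ := abs_sub_le (s K x) (t K x) (t l x)
        rw [abs_sub_comm (t K x)] at h₂
        simp only [SimpleFunc.map_apply, SimpleFunc.coe_sub, SimpleFunc.coe_add, Pi.sub_apply,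
          Pi.add_apply, SimpleFunc.const_apply]
        linarith [hM' x])
    rw [simpleIntegral_add, simpleIntegral_add, simpleIntegral_const] at hle
    have hAB : (|M| + 1) * μ (A ∪ B) ≤ ε / 2 := by
      have : μ (A ∪ B) ≤ 2 * (ε / 4 / (|M| + 1)) := by linarith [hμ.union_le hA hB]
      calc (|M| + 1) * μ (A ∪ B) ≤ (|M| + 1) * (2 * (ε / 4 / (|M| + 1))) := by gcongr
        _ = ε / 2 := by field_simp; ring
    linarith [hsK l hl, htK l hl]
  exact le_of_tendsto (hs.sub ht).abs key

theorem Nonneg.outerVar_congr_null (hμ : μ.Nonneg) {S T N : Set X} (hN : MeasurableSet N)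
    (hN0 : μ N = 0) (h : S ⊆ T ∪ N) : μ.outerVar S ≤ μ.outerVar T := by
  refine le_of_forall_gt fun r hr => ?_
  obtain ⟨A, hA, hTA, hAr⟩ := hμ.exists_lt_of_outerVar_lt hr
  have := hμ.outerVar_le (hA.union hN) (h.trans (union_subset_union_left N hTA))
  linarith [hμ.union_le hA hN]

/-- Changing the integrand on a null set does not change the integral. -/
theorem HasIntegral.congr (hμ : μ.Nonneg) {f g : X → ℝ} {N : Set X} (hN : MeasurableSet N)
    (hN0 : μ N = 0) (hfg : ∀ x ∉ N, f x = g x) {c : ℝ} (hf : μ.HasIntegral f c) :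
    μ.HasIntegral g c := by
  obtain ⟨s, ⟨hm, hs⟩, hc⟩ := hf
  refine ⟨s, ⟨fun ε hε => ?_, hs⟩, hc⟩
  refine squeeze_zero (fun _ => hμ.outerVar_nonneg _) (fun k => ?_) (hm ε hε)
  refine hμ.outerVar_congr_null hN hN0 fun x hx => ?_
  by_cases hxN : x ∈ N
  · exact .inr hxN
  · exact .inl (by simpa [hfg x hxN] using hx)

/-! ### Bounded measurable functions. -/

/-- A sequence of simple functions converging uniformly to `g`, with rate `1 / (k + 1)`. -/
def IsUniformApprox (s : ℕ → SimpleFunc X ℝ) (g : X → ℝ) : Prop :=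
  ∀ k x, |s k x - g x| ≤ 1 / ((k : ℝ) + 1)

theorem exists_isUniformApprox {g : X → ℝ} (hg : Measurable g) {C : ℝ} (hC : ∀ x, |g x| ≤ C) :
    ∃ s : ℕ → SimpleFunc X ℝ, IsUniformApprox s g := by
  -- Rounding `g` down to multiples of `1 / (k + 1)`; boundedness of `g` leaves finitely many
  -- values.
  refine ⟨fun k => ⟨fun x => (⌊((k : ℝ) + 1) * g x⌋ : ℝ) / ((k : ℝ) + 1), fun y => ?_, ?_⟩,
    fun k x => ?_⟩
  · exact (((measurable_from_top (f := fun z : ℤ => (z : ℝ))).comp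
      (hg.const_mul _).floor).div_const _) (measurableSet_singleton y)
  · refine (((finite_Icc (⌊-(((k : ℝ) + 1) * C)⌋) (⌊((k : ℝ) + 1) * C⌋))).image
      fun z : ℤ => (z : ℝ) / ((k : ℝ) + 1)).subset ?_
    rintro _ ⟨x, rfl⟩
    have hx := abs_le.1 (hC x)
    refine ⟨_, ⟨Int.floor_mono ?_, Int.floor_mono ?_⟩, rfl⟩
    · rw [← mul_neg]
      exact mul_le_mul_of_nonneg_left hx.1 (by positivity)
    · exact mul_le_mul_of_nonneg_left hx.2 (by positivity)
  · have hk : (0 : ℝ) < (k : ℝ) + 1 := by positivity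
    have h₁ := Int.floor_le (((k : ℝ) + 1) * g x)
    have h₂ := Int.lt_floor_add_one (((k : ℝ) + 1) * g x)
    change |(⌊((k : ℝ) + 1) * g x⌋ : ℝ) / ((k : ℝ) + 1) - g x| ≤ _
    rw [div_sub' hk.ne', abs_div, abs_of_pos hk]
    gcongr
    rw [abs_le]
    constructor <;> linarith

theorem IsUniformApprox.isDetermining {s : ℕ → SimpleFunc X ℝ} {g : X → ℝ}
    (hs : IsUniformApprox s g) (hμ : μ.Nonneg) : μ.IsDetermining s g := by
  refine ⟨fun ε hε => ?_, ?_⟩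
  · refine tendsto_const_nhds.congr' ?_
    filter_upwards [tendsto_one_div_add_atTop_nhds_zero_nat.eventually (gt_mem_nhds hε)] with k hk
    have : {x | ε < |s k x - g x|} = ∅ :=
      eq_empty_of_forall_notMem fun x hx => absurd (hs k x) (not_le.2 (hk.trans hx))
    rw [this]
    exact le_antisymm (hμ.outerVar_nonneg _)
      ((hμ.outerVar_le .empty subset_rfl).trans_eq μ.apply_empty)
  · have h₀ := tendsto_one_div_add_atTop_nhds_zero_nat (𝕜 := ℝ)
    have h₁ : Tendsto (fun p : ℕ × ℕ => (1 / ((p.1 : ℝ) + 1) + 1 / ((p.2 : ℝ) + 1)) * μ univ)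
        atTop (𝓝 0) := by
      rw [← prod_atTop_atTop_eq]
      simpa using ((h₀.comp tendsto_fst).add (h₀.comp tendsto_snd)).mul_const (μ univ)
    refine squeeze_zero (fun p => ?_) (fun p => ?_) h₁
    · rw [hμ.simpleIntegral_totalVar]
      exact (abs_nonneg _).trans (hμ.abs_simpleIntegral_sub_le _ _)
    · rw [hμ.simpleIntegral_totalVar, ← simpleIntegral_const]
      refine hμ.simpleIntegral_mono fun x => ?_
      have := abs_sub_le (s p.1 x) (g x) (s p.2 x)
      rw [abs_sub_comm (g x)] at this
      simpa using this.trans (add_le_add (hs _ x) (hs _ x))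

theorem Nonneg.existsUnique_hasIntegral (hμ : μ.Nonneg) {g : X → ℝ} (hg : Measurable g) {C : ℝ}
    (hC : ∀ x, |g x| ≤ C) : ∃! c, μ.HasIntegral g c := by
  obtain ⟨s, hs⟩ := exists_isUniformApprox hg hC
  obtain ⟨c, hc⟩ := hμ.exists_tendsto_of_isDetermining (hs.isDetermining hμ)
  exact ⟨c, ⟨s, hs.isDetermining hμ, hc⟩, fun d hd =>
    hμ.hasIntegral_unique hd ⟨s, hs.isDetermining hμ, hc⟩⟩

theorem HasIntegral.tendsto (hμ : μ.Nonneg) {g : X → ℝ} {c : ℝ} (hc : μ.HasIntegral g c)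
    {s : ℕ → SimpleFunc X ℝ} (hs : IsUniformApprox s g) :
    Tendsto (fun k => simpleIntegral μ (s k)) atTop (𝓝 c) := by
  obtain ⟨d, hd⟩ := hμ.exists_tendsto_of_isDetermining (hs.isDetermining hμ)
  rwa [hμ.hasIntegral_unique hc ⟨s, hs.isDetermining hμ, hd⟩]

theorem HasIntegral.le_of_null (hμ : μ.Nonneg) (h1 : μ univ = 1) {g : X → ℝ} (hg : Measurable g)
    {C : ℝ} (hC : ∀ x, |g x| ≤ C) {c : ℝ} (hc : μ.HasIntegral g c) {A : Set X}
    (hA : MeasurableSet A) (hA0 : μ A = 0) {M : ℝ} (hM : ∀ x ∉ A, g x ≤ M) : c ≤ M := by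
  obtain ⟨s, hs⟩ := exists_isUniformApprox hg hC
  have h := tendsto_one_div_add_atTop_nhds_zero_nat (𝕜 := ℝ) |>.const_add M
  rw [add_zero] at h
  refine le_of_tendsto_of_tendsto' (hc.tendsto hμ hs) h fun k => ?_
  -- Total mass 1 makes the constant its own integral, to be compared with `s k` off `A`.
  have h2 := simpleIntegral_const μ (M + 1 / ((k : ℝ) + 1))
  rw [h1, mul_one] at h2
  rw [← h2]
  refine hμ.simpleIntegral_le_of_null hA hA0 fun x hx => ?_
  have := (le_abs_self _).trans (hs k x)
  simp only [SimpleFunc.const_apply]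
  linarith [hM x hx]

theorem HasIntegral.ge_of_null (hμ : μ.Nonneg) (h1 : μ univ = 1) {g : X → ℝ} (hg : Measurable g)
    {C : ℝ} (hC : ∀ x, |g x| ≤ C) {c : ℝ} (hc : μ.HasIntegral g c) {A : Set X}
    (hA : MeasurableSet A) (hA0 : μ A = 0) {M : ℝ} (hM : ∀ x ∉ A, M ≤ g x) : M ≤ c := by
  obtain ⟨s, hs⟩ := exists_isUniformApprox hg hC
  have h := tendsto_one_div_add_atTop_nhds_zero_nat (𝕜 := ℝ) |>.const_sub M
  rw [sub_zero] at h
  refine le_of_tendsto_of_tendsto' h (hc.tendsto hμ hs) fun k => ?_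
  have h2 := simpleIntegral_const μ (M - 1 / ((k : ℝ) + 1))
  rw [h1, mul_one] at h2
  rw [← h2]
  refine hμ.simpleIntegral_le_of_null hA hA0 fun x hx => ?_
  have := (neg_abs_le _).trans' (neg_le_neg (hs k x))
  simp only [SimpleFunc.const_apply]
  linarith [hM x hx]

/-! ### Convex combinations and ultrafilter charges. -/

/-- The combination `t μ + u ν` of two charges. -/
def combo (t u : ℝ) (μ ν : BddCharge X) : BddCharge X where
  toFun A := t * μ A + u * ν A
  not_measurable' A hA := by simp [μ.not_measurable' A hA, ν.not_measurable' A hA]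
  additive' A B hA hB hAB := by
    rw [μ.additive' A B hA hB hAB, ν.additive' A B hA hB hAB]
    ring
  bounded' := by
    obtain ⟨C, hC⟩ := μ.bounded'
    obtain ⟨D, hD⟩ := ν.bounded'
    refine ⟨|t| * C + |u| * D, fun A hA => (abs_add_le _ _).trans ?_⟩
    rw [abs_mul, abs_mul]
    gcongr
    exacts [hC A hA, hD A hA]

theorem combo_apply (t u : ℝ) (μ ν : BddCharge X) (A : Set X) :
    combo t u μ ν A = t * μ A + u * ν A := rfl

theorem simpleIntegral_combo (t u : ℝ) (μ ν : BddCharge X) (s : SimpleFunc X ℝ) :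
    simpleIntegral (combo t u μ ν) s = t * simpleIntegral μ s + u * simpleIntegral ν s := by
  simp only [simpleIntegral, Finset.mul_sum, ← Finset.sum_add_distrib, combo_apply]
  exact Finset.sum_congr rfl fun y _ => by ring

theorem Nonneg.combo {ν : BddCharge X} (hμ : μ.Nonneg) (hν : ν.Nonneg) {t u : ℝ} (ht : 0 ≤ t)
    (hu : 0 ≤ u) : (combo t u μ ν).Nonneg := fun A hA =>
  add_nonneg (mul_nonneg ht (hμ A hA)) (mul_nonneg hu (hν A hA))

theorem HasIntegral.combo {ν : BddCharge X} (hμ : μ.Nonneg) (hν : ν.Nonneg) {t u : ℝ} (ht : 0 ≤ t)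
    (hu : 0 ≤ u) {g : X → ℝ} (hg : Measurable g) {C : ℝ} (hC : ∀ x, |g x| ≤ C) {c d : ℝ}
    (hc : μ.HasIntegral g c) (hd : ν.HasIntegral g d) :
    (combo t u μ ν).HasIntegral g (t * c + u * d) := by
  obtain ⟨s, hs⟩ := exists_isUniformApprox hg hC
  refine ⟨s, hs.isDetermining (hμ.combo hν ht hu), ?_⟩
  simp only [simpleIntegral_combo]
  exact ((hc.tendsto hμ hs).const_mul t).add ((hd.tendsto hν hs).const_mul u)

/-- The `0`-`1`-valued charge of an ultrafilter. -/
noncomputable def ofUltrafilter (U : Ultrafilter X) : BddCharge X where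
  toFun A := open Classical in if MeasurableSet A ∧ A ∈ U then 1 else 0
  not_measurable' A hA := by simp [hA]
  additive' A B hA hB hAB := by
    by_cases h₁ : A ∈ U <;> by_cases h₂ : B ∈ U
    · exact absurd (U.inter_sets h₁ h₂) (by
        change A ∩ B ∉ U
        rw [hAB.inter_eq]; exact U.empty_notMem)
    all_goals simp [hA, hB, hA.union hB, h₁, h₂, Ultrafilter.union_mem_iff]
  bounded' := ⟨1, fun A _ => by split_ifs <;> simp⟩

theorem ofUltrafilter_of_mem {U : Ultrafilter X} {A : Set X} (hA : MeasurableSet A) (h : A ∈ U) :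
    ofUltrafilter U A = 1 := if_pos ⟨hA, h⟩

theorem ofUltrafilter_of_compl_mem {U : Ultrafilter X} {A : Set X} (h : Aᶜ ∈ U) :
    ofUltrafilter U A = 0 := if_neg fun h' => Ultrafilter.compl_mem_iff_notMem.1 h h'.2

theorem nonneg_ofUltrafilter (U : Ultrafilter X) : (ofUltrafilter U).Nonneg := fun A _ => by
  simp only [ofUltrafilter]
  split_ifs <;> simp

/-- The integral against the charge of an ultrafilter is the limit along the ultrafilter. -/
theorem hasIntegral_ofUltrafilter {U : Ultrafilter X} {g : X → ℝ} (hg : Measurable g) {C : ℝ}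
    (hC : ∀ x, |g x| ≤ C) {b : ℝ} (hb : Tendsto g U (𝓝 b)) :
    (ofUltrafilter U).HasIntegral g b := by
  have hμ := nonneg_ofUltrafilter U
  have h1 : ofUltrafilter U univ = 1 := ofUltrafilter_of_mem .univ univ_mem
  obtain ⟨c, hc, -⟩ := hμ.existsUnique_hasIntegral hg hC
  convert hc
  refine le_antisymm (le_of_forall_lt_imp_le_of_dense fun M hM => ?_)
    (le_of_forall_gt_imp_ge_of_dense fun M hM => ?_)
  -- For `M < b` the set `{g < M}` is not in `U`, so it has charge 0.
  · refine hc.ge_of_null hμ h1 hg hC (A := {x | g x < M}) (measurableSet_lt hg measurable_const)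
      (ofUltrafilter_of_compl_mem ?_) fun x hx => not_lt.1 hx
    filter_upwards [hb.eventually (lt_mem_nhds hM)] with x hx using not_lt.2 hx.le
  · refine hc.le_of_null hμ h1 hg hC (A := {x | M < g x}) (measurableSet_lt measurable_const hg)
      (ofUltrafilter_of_compl_mem ?_) fun x hx => not_lt.1 hx
    filter_upwards [hb.eventually (gt_mem_nhds hM)] with x hx using not_lt.2 hx.le

end BddCharge

/-! ### Essential bounds on shrinking sets. -/

theorem isBoundedUnder_le_of_abs_le {X : Type*} {g : X → ℝ} {C : ℝ}
    (hC : ∀ x, |g x| ≤ C) (l : Filter X) :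
    l.IsBoundedUnder (· ≤ ·) g :=
  isBoundedUnder_of ⟨C, fun x => (abs_le.1 (hC x)).2⟩

theorem isBoundedUnder_ge_of_abs_le {X : Type*} {g : X → ℝ} {C : ℝ}
    (hC : ∀ x, |g x| ≤ C) (l : Filter X) :
    l.IsBoundedUnder (· ≥ ·) g :=
  isBoundedUnder_of ⟨-C, fun x => (abs_le.1 (hC x)).1⟩

/-- For a decreasing family of sets of positive measure, the essential suprema of a bounded
function have a limit from the right at `0`, which is a lower bound of them. -/
theorem exists_tendsto_essSup {X : Type*} [MeasurableSpace X] {m : Measure X} {S : ℝ → Set X}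
    (hS : Monotone S) (hpos : ∀ δ, 0 < δ → m (S δ) ≠ 0) {g : X → ℝ} {C : ℝ} (hC : ∀ x, |g x| ≤ C) :
    ∃ b, Tendsto (fun δ => essSup g (m.restrict (S δ))) (𝓝[>] 0) (𝓝 b) ∧
      ∀ δ, 0 < δ → b ≤ essSup g (m.restrict (S δ)) := by
  -- On a null set the a.e. filter is trivial and the real `essSup` takes the default value 0, which
  -- would break monotonicity.
  have hne : ∀ δ, 0 < δ → (ae (m.restrict (S δ))).NeBot := fun δ hδ =>
    ae_neBot.2 (Measure.restrict_eq_zero.not.2 (hpos δ hδ))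
  have hmono : MonotoneOn (fun δ => essSup g (m.restrict (S δ))) (Ioi 0) := by
    intro δ hδ ε _ h
    have := hne δ hδ
    exact limsup_le_limsup_of_le (ae_mono (Measure.restrict_mono (hS h) le_rfl))
      (isBoundedUnder_ge_of_abs_le hC _).isCoboundedUnder_le (isBoundedUnder_le_of_abs_le hC _)
  have hbdd : BddBelow ((fun δ => essSup g (m.restrict (S δ))) '' Ioi 0) := by
    refine ⟨-C, ?_⟩
    rintro _ ⟨δ, hδ, rfl⟩
    have := hne δ hδ
    exact le_limsup_of_frequently_le (Eventually.frequently <| .of_forall fun x =>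
      (abs_le.1 (hC x)).1) (isBoundedUnder_le_of_abs_le hC _)
  exact ⟨_, hmono.tendsto_nhdsGT hbdd, fun δ hδ => csInf_le hbdd ⟨δ, hδ, rfl⟩⟩

/-- For a decreasing family of sets of positive measure, the essential infima of a bounded
function have a limit from the right at `0`, which is a upper bound of them. -/
theorem exists_tendsto_essInf {X : Type*} [MeasurableSpace X] {m : Measure X} {S : ℝ → Set X}
    (hS : Monotone S) (hpos : ∀ δ, 0 < δ → m (S δ) ≠ 0) {g : X → ℝ} {C : ℝ} (hC : ∀ x, |g x| ≤ C) :
    ∃ b, Tendsto (fun δ => essInf g (m.restrict (S δ))) (𝓝[>] 0) (𝓝 b) ∧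
      ∀ δ, 0 < δ → essInf g (m.restrict (S δ)) ≤ b := by
  have hne : ∀ δ, 0 < δ → (ae (m.restrict (S δ))).NeBot := fun δ hδ =>
    ae_neBot.2 (Measure.restrict_eq_zero.not.2 (hpos δ hδ))
  have hanti : AntitoneOn (fun δ => essInf g (m.restrict (S δ))) (Ioi 0) := by
    intro δ hδ ε _ h
    have := hne δ hδ
    exact liminf_le_liminf_of_le (ae_mono (Measure.restrict_mono (hS h) le_rfl))
      (isBoundedUnder_ge_of_abs_le hC _) (isBoundedUnder_le_of_abs_le hC _).isCoboundedUnder_ge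
  have hbdd : BddAbove ((fun δ => essInf g (m.restrict (S δ))) '' Ioi 0) := by
    refine ⟨C, ?_⟩
    rintro _ ⟨δ, hδ, rfl⟩
    have := hne δ hδ
    exact liminf_le_of_frequently_le (Eventually.frequently <| .of_forall fun x =>
      (abs_le.1 (hC x)).2) (isBoundedUnder_ge_of_abs_le hC _)
  exact ⟨_, hanti.tendsto_nhdsGT hbdd, fun δ hδ => le_csSup hbdd ⟨δ, hδ, rfl⟩⟩


/-! ### Neighbourhoods of `F` and density measures. -/

variable {n : ℕ} {Ω F : Set (EuclideanSpace ℝ (Fin n))}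

theorem measurableSet_nhdIn (Ω F : Set (EuclideanSpace ℝ (Fin n))) (δ : ℝ) :
    MeasurableSet (nhdIn Ω F δ) :=
  (Metric.isOpen_thickening.preimage continuous_subtype_val).measurableSet

theorem monotone_nhdIn (Ω F : Set (EuclideanSpace ℝ (Fin n))) : Monotone (nhdIn Ω F) :=
  fun _ _ h _ hx => Metric.thickening_mono h F hx

theorem lebesgueOn_nhdIn (hΩ : MeasurableSet Ω) (δ : ℝ) :
    lebesgueOn Ω (nhdIn Ω F δ) = volume (Metric.thickening δ F ∩ Ω) := by
  rw [lebesgueOn, (MeasurableEmbedding.subtype_coe hΩ).comap_apply]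
  congr 1
  ext x
  simp [nhdIn, and_comm]

namespace IsDensityMeasure

variable {μ ν : BddCharge Ω}

/-- The part of `A` inside the neighbourhood is Lebesgue null, and the outside has charge `1 - 1 =
0`. -/
theorem apply_eq_zero (hμ : IsDensityMeasure Ω F μ) {δ : ℝ} (hδ : 0 < δ) {A : Set Ω}
    (hA : MeasurableSet A) (h : ∀ᵐ x ∂(lebesgueOn Ω).restrict (nhdIn Ω F δ), x ∉ A) :
    μ A = 0 := by
  have hS := measurableSet_nhdIn Ω F δ
  have h₀ : μ (A ∩ nhdIn Ω F δ) = 0 := by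
    refine hμ.weaklyAbsCont _ (hA.inter hS) ?_
    rw [← Measure.restrict_apply hA]
    exact compl_mem_ae_iff.1 h
  have h₁ : μ (nhdIn Ω F δ)ᶜ = 0 := by
    have := μ.additive' _ _ hS hS.compl disjoint_compl_right
    rw [union_compl_self, hμ.total, hμ.nhd δ hδ] at this
    linarith
  refine le_antisymm ?_ (hμ.nonneg A hA)
  have h₂ : A ⊆ A ∩ nhdIn Ω F δ ∪ (nhdIn Ω F δ)ᶜ := fun x hx =>
    (em (x ∈ nhdIn Ω F δ)).imp (fun h => ⟨hx, h⟩) id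
  have h₃ := hμ.nonneg.mono hA ((hA.inter hS).union hS.compl) h₂
  linarith [hμ.nonneg.union_le (hA.inter hS) hS.compl]

theorem combo (hμ : IsDensityMeasure Ω F μ) (hν : IsDensityMeasure Ω F ν) {t u : ℝ} (ht : 0 ≤ t)
    (hu : 0 ≤ u) (htu : t + u = 1) : IsDensityMeasure Ω F (BddCharge.combo t u μ ν) where
  nonneg := hμ.nonneg.combo hν.nonneg ht hu
  weaklyAbsCont A hA hA0 := by
    simp [BddCharge.combo_apply, hμ.weaklyAbsCont A hA hA0, hν.weaklyAbsCont A hA hA0]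
  total := by simp [BddCharge.combo_apply, hμ.total, hν.total, htu]
  nhd δ hδ := by simp [BddCharge.combo_apply, hμ.nhd δ hδ, hν.nhd δ hδ, htu]

end IsDensityMeasure

theorem isDensityMeasure_ofUltrafilter {U : Ultrafilter Ω} (hU : ↑U ≤ ae (lebesgueOn Ω))
    (hF : ∀ δ, 0 < δ → nhdIn Ω F δ ∈ U) :
    IsDensityMeasure Ω F (BddCharge.ofUltrafilter U) where
  nonneg := BddCharge.nonneg_ofUltrafilter U
  weaklyAbsCont _ _ hA0 := BddCharge.ofUltrafilter_of_compl_mem (hU (compl_mem_ae_iff.2 hA0))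
  total := BddCharge.ofUltrafilter_of_mem .univ univ_mem
  nhd δ hδ := BddCharge.ofUltrafilter_of_mem (measurableSet_nhdIn Ω F δ) (hF δ hδ)

/-- An essential cluster value of `g` at `F` is the integral of `g` against a density measure. -/
theorem exists_isDensityMeasure_hasIntegral (hFne : F.Nonempty) {g : Ω → ℝ} (hg : Measurable g)
    {C : ℝ} (hC : ∀ x, |g x| ≤ C) {b : ℝ}
    (hb : ∀ r, 0 < r → ∃ᵐ x ∂lebesgueOn Ω, x ∈ nhdIn Ω F r ∧ |g x - b| < r) :
    ∃ μ : BddCharge Ω, IsDensityMeasure Ω F μ ∧ μ.HasIntegral g b := by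
  -- Clustering of the pair, not of each coordinate, yields one ultrafilter that both concentrates
  -- at `F` and sends `g` to `b`.
  have h : MapClusterPt ((0 : ℝ), b) (ae (lebesgueOn Ω))
      (fun x : Ω => (Metric.infDist (x : EuclideanSpace ℝ (Fin n)) F, g x)) := by
    refine Metric.nhds_basis_ball.mapClusterPt_iff_frequently.2 fun r hr => ?_
    refine (hb r hr).mono fun x hx => ?_
    have hx' := (Metric.mem_thickening_iff_infDist_lt hFne).1 hx.1
    rw [Metric.mem_ball, Prod.dist_eq, max_lt_iff, Real.dist_eq, Real.dist_eq, sub_zero,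
      abs_of_nonneg Metric.infDist_nonneg]
    exact ⟨hx', hx.2⟩
  obtain ⟨U, hU, hUt⟩ := mapClusterPt_iff_ultrafilter.1 h
  rw [nhds_prod_eq, tendsto_prod_iff'] at hUt
  refine ⟨BddCharge.ofUltrafilter U, isDensityMeasure_ofUltrafilter hU fun δ hδ => ?_,
    BddCharge.hasIntegral_ofUltrafilter hg hC hUt.2⟩
  filter_upwards [hUt.1.eventually (gt_mem_nhds hδ)] with x hx
  exact (Metric.mem_thickening_iff_infDist_lt hFne).2 hx

/-! ### The set of integrals. -/

/-- The characterisation of the integrals against density measures, for an everywhere bounded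
measurable function. -/
theorem setOf_integral_isDensityMeasure (hΩ : MeasurableSet Ω) (hFne : F.Nonempty)
    (hpos : ∀ δ : ℝ, 0 < δ → 0 < volume (Metric.thickening δ F ∩ Ω))
    {g : Ω → ℝ} (hg : Measurable g) {C : ℝ} (hC : ∀ x, |g x| ≤ C) :
    ∃ a b : ℝ, a ≤ b ∧
      Tendsto (fun δ : ℝ => essInf g ((lebesgueOn Ω).restrict (nhdIn Ω F δ))) (𝓝[>] 0) (𝓝 a) ∧
      Tendsto (fun δ : ℝ => essSup g ((lebesgueOn Ω).restrict (nhdIn Ω F δ))) (𝓝[>] 0) (𝓝 b) ∧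
      {c : ℝ | ∃ μ : BddCharge Ω, IsDensityMeasure Ω F μ ∧ μ.HasIntegral g c} = Icc a b := by
  have hpos' : ∀ δ, 0 < δ → lebesgueOn Ω (nhdIn Ω F δ) ≠ 0 := fun δ hδ => by
    rw [lebesgueOn_nhdIn hΩ]
    exact (hpos δ hδ).ne'
  have hne : ∀ δ, 0 < δ → (ae ((lebesgueOn Ω).restrict (nhdIn Ω F δ))).NeBot := fun δ hδ =>
    ae_neBot.2 (Measure.restrict_eq_zero.not.2 (hpos' δ hδ))
  obtain ⟨a, ha, ha'⟩ := exists_tendsto_essInf (monotone_nhdIn Ω F) hpos' hC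
  obtain ⟨b, hb, hb'⟩ := exists_tendsto_essSup (monotone_nhdIn Ω F) hpos' hC
  have hle := fun l => isBoundedUnder_le_of_abs_le hC l
  have hge := fun l => isBoundedUnder_ge_of_abs_le hC l
  have hub : ∀ M > b, ∀ᶠ δ in 𝓝[>] 0,
      ∀ᵐ x ∂(lebesgueOn Ω).restrict (nhdIn Ω F δ), g x < M := fun M hM => by
    filter_upwards [hb.eventually (gt_mem_nhds hM)] with δ hδ
    exact eventually_lt_of_limsup_lt hδ (hle _)
  have hlb : ∀ M < a, ∀ᶠ δ in 𝓝[>] 0,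
      ∀ᵐ x ∂(lebesgueOn Ω).restrict (nhdIn Ω F δ), M < g x := fun M hM => by
    filter_upwards [ha.eventually (lt_mem_nhds hM)] with δ hδ
    exact eventually_lt_of_lt_liminf hδ (hge _)
  have hab : a ≤ b := by
    refine le_of_tendsto_of_tendsto ha hb ?_
    filter_upwards [self_mem_nhdsWithin] with δ hδ
    have := hne δ hδ
    exact liminf_le_limsup (hle _) (hge _)
  have small : ∀ r : ℝ, 0 < r → ∀ᶠ δ in 𝓝[>] (0 : ℝ), 0 < δ ∧ δ ≤ r := fun r hr =>
    Ioc_mem_nhdsGT hr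
  obtain ⟨ν, hν, hνb⟩ := exists_isDensityMeasure_hasIntegral hFne hg hC (b := b) fun r hr => by
    -- For this small `δ`, `g < b + r` a.e. on the neighbourhood, while `b - r < b ≤ essSup` forces
    -- `g > b - r` on a non-null part of it.
    obtain ⟨δ, h₁, hδ, hδr⟩ := ((hub (b + r) (by linarith)).and (small r hr)).exists
    have := hne δ hδ
    have h₂ := frequently_lt_of_lt_limsup (hge _).isCoboundedUnder_le
      ((sub_lt_self b hr).trans_le (hb' δ hδ))
    refine ((h₂.and_eventually h₁).and_eventually
      (ae_restrict_mem (measurableSet_nhdIn Ω F δ))).filter_mono ae_restrict_le |>.mono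
        fun x hx => ⟨monotone_nhdIn Ω F hδr hx.2, ?_⟩
    rw [abs_lt]
    constructor <;> linarith [hx.1.1, hx.1.2]
  obtain ⟨μ, hμ, hμa⟩ := exists_isDensityMeasure_hasIntegral hFne hg hC (b := a) fun r hr => by
    obtain ⟨δ, h₁, hδ, hδr⟩ := ((hlb (a - r) (by linarith)).and (small r hr)).exists
    have := hne δ hδ
    have h₂ := frequently_lt_of_liminf_lt (hle _).isCoboundedUnder_ge
      ((ha' δ hδ).trans_lt (lt_add_of_pos_right a hr))
    refine ((h₂.and_eventually h₁).and_eventually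
      (ae_restrict_mem (measurableSet_nhdIn Ω F δ))).filter_mono ae_restrict_le |>.mono
        fun x hx => ⟨monotone_nhdIn Ω F hδr hx.2, ?_⟩
    rw [abs_lt]
    constructor <;> linarith [hx.1.1, hx.1.2]
  refine ⟨a, b, hab, ha, hb, Subset.antisymm ?_ fun c hc => ?_⟩
  · rintro c ⟨ρ, hρ, hc⟩
    constructor
    · refine le_of_forall_lt_imp_le_of_dense fun M hM => ?_
      obtain ⟨δ, h₁, hδ, -⟩ := ((hlb M hM).and (small 1 one_pos)).exists
      have hA : MeasurableSet {x | g x ≤ M} := measurableSet_le hg measurable_const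
      exact hc.ge_of_null hρ.nonneg hρ.total hg hC hA
        (hρ.apply_eq_zero hδ hA (h₁.mono fun x hx => not_le.2 hx)) fun x hx => (not_le.1 hx).le
    -- For `M > b` the set `{M ≤ g}` is Lebesgue null near `F`, hence null for every density
    -- measure.
    · refine le_of_forall_gt_imp_ge_of_dense fun M hM => ?_
      obtain ⟨δ, h₁, hδ, -⟩ := ((hub M hM).and (small 1 one_pos)).exists
      have hA : MeasurableSet {x | M ≤ g x} := measurableSet_le measurable_const hg
      exact hc.le_of_null hρ.nonneg hρ.total hg hC hA
        (hρ.apply_eq_zero hδ hA (h₁.mono fun x hx => not_le.2 hx)) fun x hx => (not_le.1 hx).le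
  · rw [← segment_eq_Icc hab] at hc
    obtain ⟨t, u, ht, hu, htu, rfl⟩ := hc
    exact ⟨_, hμ.combo hν ht hu htu, hμa.combo hμ.nonneg hν.nonneg ht hu hg hC hνb⟩

/-- An essentially bounded function agrees almost everywhere with a bounded measurable one. -/
theorem MeasureTheory.MemLp.exists_measurable_bounded {X : Type*} [MeasurableSpace X]
    {m : Measure X} {f : X → ℝ} (hf : MemLp f ∞ m) :
    ∃ (g : X → ℝ) (C : ℝ), Measurable g ∧ (∀ x, |g x| ≤ C) ∧ f =ᵐ[m] g := by
  have h := hf.eLpNorm_lt_top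
  rw [eLpNorm_exponent_top, eLpNormEssSup_lt_top_iff_isBoundedUnder] at h
  obtain ⟨C, hC⟩ := h
  have hfm := hf.aestronglyMeasurable
  -- Truncating the measurable representative makes the bound hold everywhere and changes it only on
  -- a null set.
  refine ⟨fun x => max (-C) (min C (hfm.mk f x)), C,
    measurable_const.max (measurable_const.min hfm.stronglyMeasurable_mk.measurable),
    fun x => ?_, ?_⟩
  · exact abs_le.2 ⟨le_max_left _ _, max_le (by linarith [C.2]) (min_le_left _ _)⟩
  · filter_upwards [hfm.ae_eq_mk, eventually_map.1 hC] with x hx hxC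
    have hxC' : |f x| ≤ C := by
      rw [← Real.norm_eq_abs]
      exact_mod_cast hxC
    rw [← hx, min_eq_right (abs_le.1 hxC').2, max_eq_right (abs_le.1 hxC').1]

theorem mainTheorem8 (n : ℕ) (Ω F : Set (EuclideanSpace ℝ (Fin n)))
    (hΩ : MeasurableSet Ω) (hFne : F.Nonempty) (hFc : IsClosed F) (hFΩ : F ⊆ closure Ω)
    (hnull : volume (F ∩ Ω) = 0)
    (hpos : ∀ δ : ℝ, 0 < δ → 0 < volume (Metric.thickening δ F ∩ Ω))
    (f : Ω → ℝ) (hf : MemLp f ∞ (lebesgueOn Ω)) :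
    (∀ μ : BddCharge Ω, IsDensityMeasure Ω F μ → ∃! c : ℝ, μ.HasIntegral f c) ∧
    ∃ a b : ℝ, a ≤ b ∧
      Tendsto (fun δ : ℝ => essInf f ((lebesgueOn Ω).restrict (nhdIn Ω F δ)))
        (𝓝[>] 0) (𝓝 a) ∧
      Tendsto (fun δ : ℝ => essSup f ((lebesgueOn Ω).restrict (nhdIn Ω F δ)))
        (𝓝[>] 0) (𝓝 b) ∧
      {c : ℝ | ∃ μ : BddCharge Ω, IsDensityMeasure Ω F μ ∧ μ.HasIntegral f c} = Icc a b := by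
  obtain ⟨g, C, hg, hC, hfg⟩ := hf.exists_measurable_bounded
  -- A charge has the meaningless value 0 off the Borel sets, so `{f ≠ g}` is enlarged to a Borel
  -- null set.
  obtain ⟨N, hNsub, hN, hN0⟩ := exists_measurable_superset_of_null (ae_iff.1 hfg)
  have hN' : ∀ x ∉ N, f x = g x := fun x hx => not_not.1 fun h => hx (hNsub h)
  have hiff : ∀ μ : BddCharge Ω, IsDensityMeasure Ω F μ → ∀ c,
      μ.HasIntegral f c ↔ μ.HasIntegral g c := fun μ hμ c => by
    have hμN := hμ.weaklyAbsCont N hN hN0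
    exact ⟨fun h => h.congr hμ.nonneg hN hμN hN',
      fun h => h.congr hμ.nonneg hN hμN fun x hx => (hN' x hx).symm⟩
  have hInf : ∀ δ, essInf f ((lebesgueOn Ω).restrict (nhdIn Ω F δ)) =
      essInf g ((lebesgueOn Ω).restrict (nhdIn Ω F δ)) := fun δ =>
    liminf_congr (ae_restrict_of_ae hfg)
  have hSup : ∀ δ, essSup f ((lebesgueOn Ω).restrict (nhdIn Ω F δ)) =
      essSup g ((lebesgueOn Ω).restrict (nhdIn Ω F δ)) := fun δ =>
    limsup_congr (ae_restrict_of_ae hfg)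
  obtain ⟨a, b, hab, ha, hb, hset⟩ := setOf_integral_isDensityMeasure hΩ hFne hpos hg hC
  refine ⟨fun μ hμ => ?_, a, b, hab, ?_, ?_, ?_⟩
  · simpa only [hiff μ hμ] using hμ.nonneg.existsUnique_hasIntegral hg hC
  · simpa only [hInf] using ha
  · simpa only [hSup] using hb
  · rw [← hset]
    ext c
    exact exists_congr fun μ => and_congr_right fun hμ => hiff μ hμ c
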